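/- Let $(\Omega,\mathcal F,\mathbb P)$ be a probability space (for instance a standard non-atomic one) and let $W\in L^2(\Omega,\mathcal F,\mathbb P)$ be the principal's random income. Agents have types $\theta\in\Theta=[a,1]$ with $0<a\le 1$; an agent of type $\theta$ derives from a claim $Y\in L^2(\mathbb P)$ the utility $U(\theta,Y)=\mathbb E[Y]-\theta\,\mathrm{Var}[Y]$. Let $\mu$ be a finite Borel measure on $\Theta$ (the distribution of types; for instance a probability measure, or $d\mu(\theta)=d\theta$). A catalogue $(X,\pi)$ consists of a function $X:\Omega\times\Theta\to\mathbb R$, with $X(\theta)=X(\cdot,\theta)$, which is $\sigma(W)\otimes\mathcal B(\Theta)$-measurable, satisfies $X\in L^2(\mathbb P\otimes\mu)$, and has $X(\theta)\in L^2(\mathbb P)$ for every $\theta\in\Theta$, together with a $\mu$-integrable price function $\pi:\Theta\to\mathbb R$. It is incentive compatible if $U(\theta,X(\theta))-\pi(\theta)\ge U(\theta,X(\theta'))-\pi(\theta')$ for all $\theta,\theta'\in\Theta$, and individually rational if $U(\theta,X(\theta))-\pi(\theta)\ge 0$ for all $\theta\in\Theta$. Let $\varrho:L^2(\mathbb P)\to\mathbb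 R\cup\{\infty\}$ be a coherent, law-invariant risk measure with the Fatou property, that is, for all $Y,Z\in L^2(\mathbb P)$: $\varrho(Y)\ge\varrho(Z)$ if $Y\le Z$ almost surely; $\varrho(Y+m)=\varrho(Y)-m$ for $m\in\mathbb R$; $\varrho(tY+(1-t)Z)\le t\varrho(Y)+(1-t)\varrho(Z)$ for $t\in[0,1]$ (with $0\cdot\infty=0$); $\varrho(tY)=t\varrho(Y)$ for $t\ge 1$ (equivalently, for all $t>0$); $\varrho(Y)=\varrho(Z)$ if $Y$ and $Z$ have the same law; and $\varrho(Z)\le\liminf_n\varrho(Y_n)$ whenever $Y_n\to Z$ in $L^2(\mathbb P)$. Then the principal's problem $$\inf\left\{\varrho\left(W+\int_\Theta(\pi(\theta)-X(\theta))\,d\mu(\theta)\right)\;:\;(X,\pi)\text{ is an incentive compatible and individually rational catalogue}\right\}$$ has a solution: there is an incentive compatible and individually rational catalogue at which the infimum is attained. -/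

import Mathlib

open MeasureTheory ProbabilityTheory Filter Topology

noncomputable section

namespace PrincipalAgent

variable {Ω : Type*} [MeasurableSpace Ω]

/-- The expected utility `U(θ, Y) = E[Y] - θ Var[Y]` that an agent with risk aversion `θ`
draws from a claim `Y`.  It is only used for square integrable `Y`. -/
def utility (P : Measure Ω) (θ : ℝ) (Y : Ω → ℝ) : ℝ :=
  (∫ ω, Y ω ∂P) - θ * variance Y P

/-- A catalogue `(X, π)` for the type space `Θ = [a, 1]`, written on the income `W`.
The contract `X` is a square integrable, `σ(W) ⊗ B(Θ)`-measurable function of scenario and type,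
each of its claims `X θ` lies in `L²(P)` (so that every agent can evaluate every claim on offer),
and the prices are integrable (so that the principal's cash revenue is defined). -/
structure Catalogue (P : Measure Ω) (W : Ω → ℝ) (a : ℝ) (μ : Measure (Set.Icc a 1)) where
  /-- the claim intended for each type -/
  X : Set.Icc a 1 → Ω → ℝ
  /-- the price of the claim intended for each type -/
  π : Set.Icc a 1 → ℝ
  measurable_X :
    Measurable[(MeasurableSpace.comap W inferInstance).prod inferInstance]
      (fun p : Ω × Set.Icc a 1 => X p.2 p.1)
  memLp_X : MemLp (fun p : Ω × Set.Icc a 1 => X p.2 p.1) 2 (P.prod μ)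
  memLp_claim : ∀ θ, MemLp (X θ) 2 P
  integrable_π : Integrable π μ

/-- Averaging a square integrable function over one variable leaves a square integrable function
of the other one. -/
theorem memLp_average {T : Type*} [MeasurableSpace T] {P : Measure Ω} [IsFiniteMeasure P]
    {μ : Measure T} [IsFiniteMeasure μ] {f : Ω × T → ℝ} (hf : MemLp f 2 (P.prod μ)) :
    MemLp (fun ω => ∫ t, f (ω, t) ∂μ) 2 P := by
  have hint : Integrable f (P.prod μ) := hf.integrable (by norm_num)
  have hsq : Integrable (fun p => f p ^ 2) (P.prod μ) := hf.integrable_sq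
  have hmeas : AEStronglyMeasurable (fun ω => ∫ t, f (ω, t) ∂μ) P :=
    hint.integral_prod_left.aestronglyMeasurable
  rw [memLp_two_iff_integrable_sq hmeas]
  refine (hsq.integral_prod_left.const_mul (μ.real Set.univ)).mono' (hmeas.pow 2) ?_
  filter_upwards [hint.prod_right_ae, hsq.prod_right_ae] with ω h1 h2
  rw [Real.norm_eq_abs, abs_of_nonneg (sq_nonneg _)]
  rcases eq_or_ne (μ.real Set.univ) 0 with hm | hm
  · have h0 : μ = 0 := by
      rwa [measureReal_eq_zero_iff, Measure.measure_univ_eq_zero] at hm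
    simp [h0]
  · have hpos : 0 < μ.real Set.univ := lt_of_le_of_ne measureReal_nonneg (Ne.symm hm)
    set m := μ.real Set.univ with hmdef
    set g := ∫ t, f (ω, t) ∂μ with hg
    have hnn : 0 ≤ ∫ t, (m * f (ω, t) - g) ^ 2 ∂μ := integral_nonneg fun t => sq_nonneg _
    have hexp : ∫ t, (m * f (ω, t) - g) ^ 2 ∂μ
        = m ^ 2 * (∫ t, f (ω, t) ^ 2 ∂μ) - 2 * m * g * g + m * g ^ 2 := by
      have : ∀ t, (m * f (ω, t) - g) ^ 2
          = m ^ 2 * f (ω, t) ^ 2 - 2 * m * g * f (ω, t) + g ^ 2 := fun t => by ring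
      simp_rw [this]
      have i2 : Integrable (fun t => m ^ 2 * f (ω, t) ^ 2) μ := h2.const_mul _
      have i1 : Integrable (fun t => 2 * m * g * f (ω, t)) μ := h1.const_mul _
      have i21 : Integrable (fun t => m ^ 2 * f (ω, t) ^ 2 - 2 * m * g * f (ω, t)) μ := i2.sub i1
      rw [integral_add i21 (integrable_const _), integral_sub i2 i1, integral_const_mul, integral_const_mul,
        integral_const, ← hmdef, ← hg, smul_eq_mul]
    rw [hexp] at hnn
    have : 0 ≤ m * (m * (∫ t, f (ω, t) ^ 2 ∂μ) - g ^ 2) := by linarith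
    have := nonneg_of_mul_nonneg_right this hpos
    linarith

namespace Catalogue

variable {P : Measure Ω} {W : Ω → ℝ} {a : ℝ} {μ : Measure (Set.Icc a 1)}

/-- Incentive compatibility: no type gains from choosing the claim intended for another type. -/
def IncentiveCompatible (C : Catalogue P W a μ) : Prop :=
  ∀ θ θ' : Set.Icc a 1,
    utility P θ (C.X θ') - C.π θ' ≤ utility P θ (C.X θ) - C.π θ

/-- Individual rationality: every type gets at least the reservation utility zero. -/
def IndividuallyRational (C : Catalogue P W a μ) : Prop :=
  ∀ θ : Set.Icc a 1, 0 ≤ utility P θ (C.X θ) - C.π θ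

/-- The principal's overall position `W + ∫ (π(θ) - X(θ)) dμ(θ)`. -/
def position (C : Catalogue P W a μ) : Ω → ℝ :=
  fun ω => W ω + ∫ θ, (C.π θ - C.X θ ω) ∂μ

theorem memLp_position [IsProbabilityMeasure P] [IsFiniteMeasure μ] (hW : MemLp W 2 P)
    (C : Catalogue P W a μ) : MemLp C.position 2 P := by
  have h1 : MemLp (fun ω => (W ω + ∫ θ, C.π θ ∂μ) - ∫ θ, C.X θ ω ∂μ) 2 P :=
    (hW.add (memLp_const _)).sub (memLp_average C.memLp_X)
  refine h1.ae_eq ?_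
  filter_upwards [(C.memLp_X.integrable (by norm_num)).prod_right_ae] with ω hω
  rw [position, integral_sub C.integrable_π hω]
  ring

/-- The risk of the principal's overall position. -/
def risk [IsProbabilityMeasure P] [IsFiniteMeasure μ] (ρ : Lp ℝ 2 P → EReal)
    (hW : MemLp W 2 P) (C : Catalogue P W a μ) : EReal :=
  ρ ((C.memLp_position hW).toLp C.position)

end Catalogue

/-- The admissible catalogues of the principal. -/
def feasible (P : Measure Ω) (W : Ω → ℝ) (a : ℝ) (μ : Measure (Set.Icc a 1)) :
    Set (Catalogue P W a μ) :=
  {C | C.IncentiveCompatible ∧ C.IndividuallyRational}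

/-- A solution of the principal's problem is an admissible catalogue at which the infimum of the
risk over all admissible catalogues is attained. -/
def IsSolution {P : Measure Ω} [IsProbabilityMeasure P] {W : Ω → ℝ} {a : ℝ}
    {μ : Measure (Set.Icc a 1)} [IsFiniteMeasure μ] (ρ : Lp ℝ 2 P → EReal) (hW : MemLp W 2 P)
    (C : Catalogue P W a μ) : Prop :=
  C ∈ feasible P W a μ ∧ C.risk ρ hW = ⨅ C' ∈ feasible P W a μ, C'.risk ρ hW

/-- Coherent risk measures on `L²(P)` with values in `ℝ ∪ {∞}`: monotone, cash invariant, convex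
and positively homogeneous.  Homogeneity for factors `t ≥ 1` gives it for all `t > 0`, upon
applying it to the factor `1 / t`. -/
structure IsCoherent {P : Measure Ω} [IsProbabilityMeasure P] (ρ : Lp ℝ 2 P → EReal) :
    Prop where
  ne_bot : ∀ Y, ρ Y ≠ ⊥
  antitone : ∀ Y Z : Lp ℝ 2 P, Y ≤ Z → ρ Z ≤ ρ Y
  cash_invariant : ∀ (Y : Lp ℝ 2 P) (m : ℝ), ρ (Y + Lp.const 2 P m) = ρ Y - (m : EReal)
  convex : ∀ (Y Z : Lp ℝ 2 P) (t : ℝ), 0 ≤ t → t ≤ 1 →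
    ρ (t • Y + (1 - t) • Z) ≤ (t : EReal) * ρ Y + ((1 - t : ℝ) : EReal) * ρ Z
  pos_homogeneous : ∀ (Y : Lp ℝ 2 P) (t : ℝ), 1 ≤ t → ρ (t • Y) = (t : EReal) * ρ Y

/-- The risk of a position depends on its law only. -/
def IsLawInvariant {P : Measure Ω} (ρ : Lp ℝ 2 P → EReal) : Prop :=
  ∀ Y Z : Lp ℝ 2 P, P.map Y = P.map Z → ρ Y = ρ Z

/-- The Fatou property: sequential lower semicontinuity for convergence in `L²`. -/
def HasFatouProperty {P : Measure Ω} (ρ : Lp ℝ 2 P → EReal) : Prop :=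
  ∀ (Y : ℕ → Lp ℝ 2 P) (Z : Lp ℝ 2 P), Tendsto Y atTop (𝓝 Z) →
    ρ Z ≤ liminf (fun n => ρ (Y n)) atTop

end PrincipalAgent

end

open MeasureTheory ProbabilityTheory Filter Topology

noncomputable section

namespace PrincipalAgent

/-! The problem reduces to minimising `ρ (W - Z) + κ ‖Z‖²` over the mean zero claims `Z` written on
`W`, for a constant `κ > 0` that depends only on `a` and `μ`.

Incentive compatibility makes the variance `q θ` of the claim `X θ` decreasing and makes `-q` a
subgradient of the indirect utility `v`. With `v 1 ≥ 0` this gives `v θ ≥ ∫_θ^1 q`, the information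
rent. Replacing prices by utilities, the principal's position is `W - Z - r`, where `Z` aggregates
the centred claims and `r = ∫ (θ q + v) dμ ≥ ∫ q dν`, with `ν` the `costMeasure`. Minkowski's
inequality gives `‖Z‖ ≤ ∫ √q dμ`. Let `κ` be the least energy `∫ c² dν` of a bounded decreasing
profile with `∫ c dμ = 1`; then `κ ‖Z‖² ≤ r`, so by cash invariance the risk is at least `ρ (W - Z)
+ κ ‖Z‖²` (`exists_centredClaim_le_risk`). Conversely, the claims `c θ · Z` with `c` an optimal
profile, priced so that each type keeps only its rent, attain this bound
(`exists_catalogue_of_profile`).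

Two minimisers remain to be found: the profile (`exists_optimal_profile`) and the claim
(`exists_min_risk_add_sq_norm`). Both come from `exists_isMinOn_add_sq_norm`: the squared norm makes
minimising sequences Cauchy by the parallelogram law, so no weak compactness is needed. -/

/-! ### Minimising a convex function plus a squared norm -/

/-- A closed convex subset of `E × ℝ` that does not contain the whole vertical line through one of
its points lies above a cone. -/
theorem exists_cone_minorant {E : Type*} [NormedAddCommGroup E] [NormedSpace ℝ E]
    {S : Set (E × ℝ)} (hS : IsClosed S) (hconv : Convex ℝ S) {z₀ : E} {r₀ h : ℝ} (hh : 0 < h)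
    (h₀ : (z₀, r₀) ∈ S) (h₁ : (z₀, r₀ - h) ∉ S) :
    ∃ C : ℝ, 0 < C ∧ ∀ p ∈ S, r₀ - C * (1 + ‖p.1 - z₀‖) ≤ p.2 := by
  obtain ⟨δ, hδ, hball⟩ := Metric.isOpen_iff.1 hS.isOpen_compl _ h₁
  -- A point `p` below the cone has depth `L > C (1 + ‖p.1 - z₀‖)`. The point of the segment from
  -- `(z₀, r₀)` to `p` with weight `h / L` has height exactly `r₀ - h`. The bound `h ≤ C` makes this
  -- weight less than one, and `h ≤ C δ` keeps the point within `δ` of the excluded one.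
  refine ⟨max h (h / δ), lt_max_of_lt_left hh, fun p hp => ?_⟩
  by_contra! hlt
  set C := max h (h / δ) with hC
  set L := r₀ - p.2 with hL
  have hCh : h ≤ C := le_max_left _ _
  have hCδ : h ≤ C * δ := (div_le_iff₀ hδ).1 (le_max_right _ _)
  have hn := norm_nonneg (p.1 - z₀)
  have hLC : C * (1 + ‖p.1 - z₀‖) < L := by linarith
  have hLpos : 0 < L := lt_of_le_of_lt (by positivity) hLC
  have hhL : h < L := by nlinarith
  have hmem : ((1 - h / L) • ((z₀, r₀) : E × ℝ) + (h / L) • p) ∈ S :=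
    hconv h₀ hp (by rw [sub_nonneg, div_le_one hLpos]; exact hhL.le) (by positivity) (by ring)
  refine hball ?_ hmem
  rw [Metric.mem_ball, Prod.dist_eq, max_lt_iff]
  constructor
  · have : ((1 - h / L) • ((z₀, r₀) : E × ℝ) + (h / L) • p).1 - z₀ = (h / L) • (p.1 - z₀) := by
      simp only [Prod.fst_add, Prod.smul_fst]
      module
    rw [dist_eq_norm]
    change ‖((1 - h / L) • ((z₀, r₀) : E × ℝ) + (h / L) • p).1 - z₀‖ < δ
    rw [this, norm_smul, Real.norm_of_nonneg (by positivity), div_mul_eq_mul_div,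
      div_lt_iff₀ hLpos]
    have : h * ‖p.1 - z₀‖ ≤ C * δ * ‖p.1 - z₀‖ := by gcongr
    nlinarith
  · have : ((1 - h / L) • ((z₀, r₀) : E × ℝ) + (h / L) • p).2 = r₀ - h := by
      simp only [Prod.snd_add, Prod.smul_snd, smul_eq_mul]
      field_simp
      rw [hL]; ring
    rw [this]
    simpa using hδ

/-- The tilted functional `(z, r) ↦ r + κ ‖z‖²` attains its minimum on a closed convex set without
vertical lines. -/
theorem exists_isMinOn_add_sq_norm {E : Type*} [NormedAddCommGroup E] [InnerProductSpace ℝ E]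
    [CompleteSpace E] {S : Set (E × ℝ)} (hS : IsClosed S) (hconv : Convex ℝ S) {z₀ : E}
    {r₀ h κ : ℝ} (hκ : 0 < κ) (hh : 0 < h) (h₀ : (z₀, r₀) ∈ S) (h₁ : (z₀, r₀ - h) ∉ S) :
    ∃ p ∈ S, ∀ p' ∈ S, p.2 + κ * ‖p.1‖ ^ 2 ≤ p'.2 + κ * ‖p'.1‖ ^ 2 := by
  obtain ⟨C, hC, hlow⟩ := exists_cone_minorant hS hconv hh h₀ h₁
  set J : E × ℝ → ℝ := fun p => p.2 + κ * ‖p.1‖ ^ 2 with hJ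
  have hne : (J '' S).Nonempty := ⟨_, _, h₀, rfl⟩
  have hbdd : BddBelow (J '' S) := by
    refine ⟨r₀ - C * (1 + ‖z₀‖) - C ^ 2 / (4 * κ), ?_⟩
    rintro _ ⟨p, hp, rfl⟩
    have h2 := hlow p hp
    have h3 : C * ‖p.1 - z₀‖ ≤ C * (‖p.1‖ + ‖z₀‖) := by gcongr; exact norm_sub_le _ _
    have h4 : C * ‖p.1‖ ≤ κ * ‖p.1‖ ^ 2 + C ^ 2 / (4 * κ) := by
      rw [← sub_nonneg]
      have : κ * ‖p.1‖ ^ 2 + C ^ 2 / (4 * κ) - C * ‖p.1‖ = (2 * κ * ‖p.1‖ - C) ^ 2 / (4 * κ) := by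
        field_simp; ring
      rw [this]; positivity
    simp only [hJ]
    linarith
  set j := sInf (J '' S) with hj
  have hjle : ∀ p ∈ S, j ≤ J p := fun p hp => csInf_le hbdd ⟨p, hp, rfl⟩
  have hex : ∀ n : ℕ, ∃ p ∈ S, J p < j + 1 / ((n : ℝ) + 1) := fun n => by
    obtain ⟨_, ⟨p, hp, rfl⟩, hlt⟩ := exists_lt_of_csInf_lt hne
      (show sInf (J '' S) < j + 1 / ((n : ℝ) + 1) by
        have : (0 : ℝ) < 1 / ((n : ℝ) + 1) := by positivity
        linarith)
    exact ⟨p, hp, hlt⟩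
  choose u huS huJ using hex
  -- Strong convexity: compare `j` with the value of `J` at the midpoint.
  have hdist : ∀ p ∈ S, ∀ p' ∈ S, κ / 4 * ‖p.1 - p'.1‖ ^ 2 ≤ (J p + J p') / 2 - j := by
    intro p hp p' hp'
    have hm : ((1 / 2 : ℝ) • p + (1 / 2 : ℝ) • p') ∈ S :=
      hconv hp hp' (by norm_num) (by norm_num) (by norm_num)
    have h1 := hjle _ hm
    have h2 : ‖(1 / 2 : ℝ) • p.1 + (1 / 2 : ℝ) • p'.1‖ ^ 2
        = (‖p.1‖ ^ 2 + ‖p'.1‖ ^ 2) / 2 - ‖p.1 - p'.1‖ ^ 2 / 4 := by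
      rw [← smul_add, norm_smul, mul_pow]
      have := parallelogram_law_with_norm ℝ p.1 p'.1
      norm_num
      linarith
    simp only [hJ, Prod.fst_add, Prod.smul_fst, Prod.snd_add, Prod.smul_snd, smul_eq_mul] at h1 ⊢
    rw [h2] at h1
    linarith
  have hlim0 : Tendsto (fun n : ℕ => 1 / ((n : ℝ) + 1)) atTop (𝓝 0) :=
    tendsto_one_div_add_atTop_nhds_zero_nat
  have hcau : CauchySeq (fun n => (u n).1) := by
    have hb : Tendsto (fun n : ℕ => Real.sqrt (4 / κ * (1 / ((n : ℝ) + 1)))) atTop (𝓝 0) := by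
      have := (hlim0.const_mul (4 / κ)).sqrt
      simpa using this
    refine cauchySeq_of_le_tendsto_0 _ (fun n m N hn hm => ?_) hb
    rw [dist_eq_norm]
    refine Real.le_sqrt_of_sq_le ?_
    have h1 := hdist _ (huS n) _ (huS m)
    have h2 : 1 / ((n : ℝ) + 1) ≤ 1 / ((N : ℝ) + 1) := by gcongr
    have h3 : 1 / ((m : ℝ) + 1) ≤ 1 / ((N : ℝ) + 1) := by gcongr
    have h4 : κ / 4 * ‖(u n).1 - (u m).1‖ ^ 2 ≤ 1 / ((N : ℝ) + 1) := by
      linarith [huJ n, huJ m]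
    have h5 : ‖(u n).1 - (u m).1‖ ^ 2 = 4 / κ * (κ / 4 * ‖(u n).1 - (u m).1‖ ^ 2) := by
      field_simp
    rw [h5]
    gcongr
  obtain ⟨z, hz⟩ := cauchySeq_tendsto_of_complete hcau
  have hJlim : Tendsto (fun n => J (u n)) atTop (𝓝 j) := by
    refine tendsto_of_tendsto_of_tendsto_of_le_of_le tendsto_const_nhds
      (by simpa using hlim0.const_add j) (fun n => hjle _ (huS n)) (fun n => (huJ n).le)
  have hrlim : Tendsto (fun n => (u n).2) atTop (𝓝 (j - κ * ‖z‖ ^ 2)) := by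
    have := hJlim.sub ((hz.norm.pow 2).const_mul κ)
    refine this.congr fun n => ?_
    simp [hJ]
  refine ⟨(z, j - κ * ‖z‖ ^ 2),
    hS.mem_of_tendsto (hz.prodMk_nhds hrlim) (Eventually.of_forall huS), fun p' hp' => ?_⟩
  have := hjle p' hp'
  simp only [hJ] at this
  simpa using this

/-! ### Decreasing profiles of least energy -/

theorem sq_norm_eq_integral_of_ae_eq {T : Type*} [MeasurableSpace T] {ν : Measure T}
    {f : Lp ℝ 2 ν} {c : T → ℝ} (h : f =ᵐ[ν] c) : ‖f‖ ^ 2 = ∫ t, c t ^ 2 ∂ν := by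
  rw [← real_inner_self_eq_norm_sq, L2.inner_def]
  refine integral_congr_ae ?_
  filter_upwards [h] with t ht
  rw [real_inner_self_eq_norm_sq, Real.norm_eq_abs, sq_abs, ht]

theorem antitone_sq {T : Type*} [Preorder T] {c : T → ℝ} {M : ℝ} (hc : Antitone c)
    (hb : ∀ t, c t ∈ Set.Icc 0 M) : Antitone (fun t => c t ^ 2) :=
  fun _ t h => pow_le_pow_left₀ (hb t).1 (hc h) 2

theorem sq_mem_Icc {T : Type*} {c : T → ℝ} {M : ℝ} (hb : ∀ t, c t ∈ Set.Icc 0 M) (t : T) :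
    c t ^ 2 ∈ Set.Icc 0 (M ^ 2) :=
  ⟨sq_nonneg _, pow_le_pow_left₀ (hb t).1 (hb t).2 2⟩

section Profiles

variable {T : Type*} [LinearOrder T] [TopologicalSpace T] [OrderClosedTopology T]
  [MeasurableSpace T] [BorelSpace T]

theorem integrable_of_antitone {μ : Measure T} [IsFiniteMeasure μ] {c : T → ℝ} {M : ℝ}
    (hc : Antitone c) (hb : ∀ t, c t ∈ Set.Icc 0 M) : Integrable c μ :=
  Integrable.of_mem_Icc 0 M hc.measurable.aemeasurable (ae_of_all _ hb)

theorem integrable_sq_of_antitone {μ : Measure T} [IsFiniteMeasure μ] {c : T → ℝ} {M : ℝ}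
    (hc : Antitone c) (hb : ∀ t, c t ∈ Set.Icc 0 M) : Integrable (fun t => c t ^ 2) μ :=
  integrable_of_antitone (antitone_sq hc hb) (sq_mem_Icc hb)

/-- Square integrable classes with a bounded decreasing representative `c`, together with the
numbers above `-2 ∫ c dμ`. -/
def profileEpigraph (μ ν : Measure T) (M : ℝ) : Set (Lp ℝ 2 ν × ℝ) :=
  {p | ∃ c : T → ℝ, Antitone c ∧ (∀ t, c t ∈ Set.Icc 0 M) ∧ p.1 =ᵐ[ν] c ∧
    -2 * ∫ t, c t ∂μ ≤ p.2}

theorem convex_profileEpigraph (μ ν : Measure T) [IsFiniteMeasure μ] (M : ℝ) :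
    Convex ℝ (profileEpigraph μ ν M) := by
  rintro p ⟨c, hc, hcb, hpc, hcr⟩ q ⟨d, hd, hdb, hqd, hdr⟩ s t hs ht hst
  refine ⟨fun x => s * c x + t * d x, fun x y h => ?_, fun x => ?_, ?_, ?_⟩
  · exact add_le_add (mul_le_mul_of_nonneg_left (hc h) hs) (mul_le_mul_of_nonneg_left (hd h) ht)
  · simpa using (convex_Icc (0 : ℝ) M) (hcb x) (hdb x) hs ht hst
  · have h1 : ((s • p + t • q).1 : T → ℝ) =ᵐ[ν] s • ⇑p.1 + t • ⇑q.1 := by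
      refine (Lp.coeFn_add (s • p.1) (t • q.1)).trans ?_
      exact (Lp.coeFn_smul s p.1).add (Lp.coeFn_smul t q.1)
    filter_upwards [h1, hpc, hqd] with x h1 h2 h3
    rw [h1]
    simp [h2, h3]
  · rw [integral_add ((integrable_of_antitone hc hcb).const_mul s)
      ((integrable_of_antitone hd hdb).const_mul t), integral_const_mul, integral_const_mul]
    simp only [Prod.snd_add, Prod.smul_snd, smul_eq_mul]
    nlinarith [mul_le_mul_of_nonneg_left hcr hs, mul_le_mul_of_nonneg_left hdr ht]

/-- A subsequence of an `L²` convergent sequence converges `ν`-almost everywhere, and the pointwise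
limsup of its representatives is decreasing and bounded at every point, not just almost everywhere.
Since `μ ≪ ν`, dominated convergence passes the linear term to the limit. -/
theorem isClosed_profileEpigraph {μ ν : Measure T} [IsFiniteMeasure μ] (hμν : μ ≪ ν) (M : ℝ) :
    IsClosed (profileEpigraph μ ν M) := by
  refine IsSeqClosed.isClosed fun p q hp hq => ?_
  choose c hc hcb hpc hcr using hp
  have h1 : Tendsto (fun n => (p n).1) atTop (𝓝 q.1) := (continuous_fst.tendsto _).comp hq
  have h2 : Tendsto (fun n => (p n).2) atTop (𝓝 q.2) := (continuous_snd.tendsto _).comp hq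
  obtain ⟨φ, hφ, hae⟩ := (tendstoInMeasure_of_tendsto_Lp h1).exists_seq_tendsto_ae
  have hlim : ∀ᵐ t ∂ν, Tendsto (fun n => c (φ n) t) atTop (𝓝 (q.1 t)) := by
    filter_upwards [hae, ae_all_iff.2 fun n => hpc (φ n)] with t ht hn
    simpa [hn] using ht
  have hbu : ∀ t, IsBoundedUnder (· ≤ ·) atTop (fun n => c (φ n) t) := fun t =>
    isBoundedUnder_of ⟨M, fun n => (hcb _ t).2⟩
  have hbl : ∀ t, IsBoundedUnder (· ≥ ·) atTop (fun n => c (φ n) t) := fun t =>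
    isBoundedUnder_of ⟨0, fun n => (hcb _ t).1⟩
  have hcl : (fun t => limsup (fun n => c (φ n) t) atTop) =ᵐ[ν] q.1 := by
    filter_upwards [hlim] with t ht using ht.limsup_eq
  refine ⟨fun t => limsup (fun n => c (φ n) t) atTop, fun s t hst => ?_, fun t => ⟨?_, ?_⟩,
    hcl.symm, ?_⟩
  · exact limsup_le_limsup (Eventually.of_forall fun n => hc (φ n) hst)
      (hbl t).isCoboundedUnder_le (hbu s)
  · exact le_limsup_of_le (hbu t) fun b hb => by
      obtain ⟨n, hn⟩ := hb.exists
      exact (hcb _ t).1.trans hn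
  · exact limsup_le_of_le (hbl t).isCoboundedUnder_le (Eventually.of_forall fun n => (hcb _ t).2)
  · rw [integral_congr_ae (hμν.ae_le hcl)]
    have hI : Tendsto (fun n => ∫ t, c (φ n) t ∂μ) atTop (𝓝 (∫ t, q.1 t ∂μ)) := by
      refine tendsto_integral_of_dominated_convergence (fun _ => M)
        (fun n => (hc _).measurable.aestronglyMeasurable) (integrable_const _)
        (fun n => ae_of_all _ fun t => ?_) (hμν.ae_le hlim)
      rw [Real.norm_of_nonneg (hcb _ t).1]
      exact (hcb _ t).2
    exact le_of_tendsto_of_tendsto' (hI.const_mul (-2)) (h2.comp hφ.tendsto_atTop)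
      fun n => hcr (φ n)

/-- Among bounded decreasing profiles, `∫ c² dν - 2 ∫ c dμ` attains its minimum. -/
theorem exists_min_profile (μ ν : Measure T) [IsFiniteMeasure μ] [IsFiniteMeasure ν] {a : ℝ}
    (ha : 0 < a) (hle : ENNReal.ofReal a • μ ≤ ν) :
    ∃ c : T → ℝ, Antitone c ∧ (∀ t, c t ∈ Set.Icc 0 (1 / a)) ∧
      ∀ (d : T → ℝ) (M : ℝ), Antitone d → (∀ t, d t ∈ Set.Icc 0 M) →
        ∫ t, c t ^ 2 ∂ν - 2 * ∫ t, c t ∂μ ≤ ∫ t, d t ^ 2 ∂ν - 2 * ∫ t, d t ∂μ := by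
  have hμν : μ ≪ ν := by
    refine Measure.AbsolutelyContinuous.trans ?_ (Measure.absolutelyContinuous_of_le hle)
    exact Measure.AbsolutelyContinuous.rfl.smul_right (by simpa using ha)
  set S := profileEpigraph μ ν (1 / a)
  have ha' : 0 ≤ 1 / a := by positivity
  have hmem : ∀ d : T → ℝ, Antitone d → (∀ t, d t ∈ Set.Icc 0 (1 / a)) →
      ∃ p ∈ S, p.1 =ᵐ[ν] d ∧ p.2 = -2 * ∫ t, d t ∂μ := by
    intro d hd hdb
    have hL : MemLp d 2 ν := (memLp_two_iff_integrable_sq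
      hd.measurable.aestronglyMeasurable).2 (integrable_sq_of_antitone hd hdb)
    exact ⟨(hL.toLp d, _), ⟨d, hd, hdb, hL.coeFn_toLp, le_rfl⟩, hL.coeFn_toLp, rfl⟩
  obtain ⟨⟨z₀, r₀⟩, hp₀, -, -⟩ := hmem (fun _ => 0) antitone_const fun _ => ⟨le_rfl, ha'⟩
  have hlow : ∀ p ∈ S, -2 * (μ.real Set.univ * (1 / a)) ≤ p.2 := by
    rintro p ⟨c, hc, hcb, -, hcr⟩
    refine le_trans ?_ hcr
    have : ∫ t, c t ∂μ ≤ ∫ _t, (1 / a) ∂μ :=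
      integral_mono (integrable_of_antitone hc hcb) (integrable_const _) fun t => (hcb t).2
    rw [integral_const, smul_eq_mul] at this
    linarith
  -- This drop from `r₀` ends one unit below the lower bound `hlow`, hence outside `S`.
  have hhp : 0 < r₀ + 2 * (μ.real Set.univ * (1 / a)) + 1 := by
    have := hlow _ hp₀
    simp only at this
    linarith
  obtain ⟨p, ⟨c, hc, hcb, hpc, hcr⟩, hmin⟩ := exists_isMinOn_add_sq_norm
    (isClosed_profileEpigraph hμν (1 / a)) (convex_profileEpigraph μ ν (1 / a)) one_pos hhp hp₀
    (fun hmem => by have := hlow _ hmem; simp only at this; linarith)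
  refine ⟨c, hc, hcb, fun d M hd hdb => ?_⟩
  -- Truncating at `1 / a` does not raise the functional: `a μ ≤ ν`, and `a x² - 2 x` is increasing
  -- for `x ≥ 1 / a`.
  have he : Antitone fun t => min (d t) (1 / a) := fun s t h => min_le_min_right _ (hd h)
  have heb : ∀ t, min (d t) (1 / a) ∈ Set.Icc 0 (1 / a) := fun t =>
    ⟨le_min (hdb t).1 ha', min_le_right _ _⟩
  obtain ⟨p', hp', hpe, hpr⟩ := hmem _ he heb
  have h1 := hmin p' hp'
  rw [sq_norm_eq_integral_of_ae_eq hpc, sq_norm_eq_integral_of_ae_eq hpe, hpr] at h1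
  have hdi := integrable_of_antitone (μ := μ) hd hdb
  have hei := integrable_of_antitone (μ := μ) he heb
  have hd2 := integrable_sq_of_antitone (μ := μ) hd hdb
  have he2 := integrable_sq_of_antitone (μ := μ) he heb
  have hd2' := integrable_sq_of_antitone (μ := ν) hd hdb
  have he2' := integrable_sq_of_antitone (μ := ν) he heb
  have h2 : a * ∫ t, (d t ^ 2 - min (d t) (1 / a) ^ 2) ∂μ
      ≤ ∫ t, (d t ^ 2 - min (d t) (1 / a) ^ 2) ∂ν := by
    have := integral_mono_measure hle (f := fun t => d t ^ 2 - min (d t) (1 / a) ^ 2)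
      (ae_of_all _ fun t => sub_nonneg.2
        (pow_le_pow_left₀ (heb t).1 (min_le_left _ _) 2)) (hd2'.sub he2')
    rwa [integral_smul_measure, ENNReal.toReal_ofReal ha.le, smul_eq_mul] at this
  have h3 : 2 * ∫ t, (d t - min (d t) (1 / a)) ∂μ
      ≤ a * ∫ t, (d t ^ 2 - min (d t) (1 / a) ^ 2) ∂μ := by
    rw [← integral_const_mul, ← integral_const_mul]
    refine integral_mono ((hdi.sub hei).const_mul 2) ((hd2.sub he2).const_mul a) fun t => ?_
    simp only
    rcases le_total (d t) (1 / a) with h | h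
    · rw [min_eq_left h]; simp
    · rw [min_eq_right h]
      have h4 : a * (1 / a) = 1 := by field_simp
      have h5 : 1 ≤ a * d t := by rw [← h4]; gcongr
      nlinarith [mul_nonneg (sub_nonneg.2 h) (sub_nonneg.2 h5)]
  rw [integral_sub hd2' he2'] at h2
  rw [integral_sub hdi hei] at h3
  linarith

/-- There is a bounded decreasing profile of unit mass whose energy bounds the energy of every
other bounded decreasing profile in terms of its mass. -/
theorem exists_optimal_profile (μ ν : Measure T) [IsFiniteMeasure μ] [IsFiniteMeasure ν] {a : ℝ}
    (ha : 0 < a) (hle : ENNReal.ofReal a • μ ≤ ν) (hμ : μ ≠ 0) :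
    ∃ (c : T → ℝ) (M : ℝ), Antitone c ∧ (∀ t, c t ∈ Set.Icc 0 M) ∧ ∫ t, c t ∂μ = 1 ∧
      0 < ∫ t, c t ^ 2 ∂ν ∧ ∀ (d : T → ℝ) (M : ℝ), Antitone d → (∀ t, d t ∈ Set.Icc 0 M) →
        (∫ t, c t ^ 2 ∂ν) * (∫ t, d t ∂μ) ^ 2 ≤ ∫ t, d t ^ 2 ∂ν := by
  obtain ⟨c, hc, hcb, hmin⟩ := exists_min_profile μ ν ha hle
  set s := ∫ t, c t ∂μ with hs
  set F := ∫ t, c t ^ 2 ∂ν with hF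
  -- Profiles form a cone, so each may be tested at its best dilation. Constants show `s > 0`, `c`
  -- itself shows `F = s`, and a general `d` dilated to the mass `s` gives the energy bound.
  have hscale : ∀ (d : T → ℝ) (M : ℝ), Antitone d → (∀ t, d t ∈ Set.Icc 0 M) → ∀ x : ℝ, 0 ≤ x →
      F - 2 * s ≤ x ^ 2 * ∫ t, d t ^ 2 ∂ν - 2 * (x * ∫ t, d t ∂μ) := by
    intro d M hd hdb x hx
    have := hmin (fun t => x * d t) (x * M) (fun s t h => mul_le_mul_of_nonneg_left (hd h) hx)
      (fun t => ⟨mul_nonneg hx (hdb t).1, mul_le_mul_of_nonneg_left (hdb t).2 hx⟩)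
    simpa only [mul_pow, integral_const_mul] using this
  have hF0 : 0 ≤ F := integral_nonneg fun t => sq_nonneg _
  have hm : 0 < μ.real Set.univ := by
    have := Measure.measure_univ_pos.2 hμ
    exact ENNReal.toReal_pos this.ne' (measure_ne_top _ _)
  have hn : 0 < ν.real Set.univ := by
    refine ENNReal.toReal_pos (fun h => ?_) (measure_ne_top _ _)
    have h1 := hle Set.univ
    rw [h, nonpos_iff_eq_zero, Measure.smul_apply, smul_eq_mul, mul_eq_zero] at h1
    rcases h1 with h1 | h1
    · exact absurd (ENNReal.ofReal_eq_zero.1 h1) (not_le.2 ha)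
    · exact hμ (Measure.measure_univ_eq_zero.1 h1)
  have hs0 : 0 < s := by
    have h1 := hscale (fun _ => 1) 1 antitone_const (fun _ => ⟨zero_le_one, le_rfl⟩)
      -- This factor minimises `x² ν(T) - 2 x μ(T)`.
      (μ.real Set.univ / ν.real Set.univ) (by positivity)
    simp only [one_pow, integral_const, smul_eq_mul, mul_one] at h1
    have h2 : (μ.real Set.univ / ν.real Set.univ) ^ 2 * ν.real Set.univ
        - 2 * (μ.real Set.univ / ν.real Set.univ * μ.real Set.univ)
        = - (μ.real Set.univ ^ 2 / ν.real Set.univ) := by field_simp; ring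
    have h3 : 0 < μ.real Set.univ ^ 2 / ν.real Set.univ := by positivity
    linarith
  have hFs : F = s := by
    have h1 := hscale c _ hc hcb
    have hFpos : 0 < F := by
      rcases hF0.eq_or_lt with h | h
      · have := h1 2 (by norm_num)
        rw [← hF, ← hs, ← h] at this
        linarith
      · exact h
    have h2 := h1 (s / F) (by positivity)
    rw [← hF, ← hs] at h2
    have h3 : (s / F) ^ 2 * F - 2 * (s / F * s) = -(s ^ 2 / F) := by field_simp; ring
    have h4 : (F - s) ^ 2 / F ≤ 0 := by
      have : (F - s) ^ 2 / F = F - 2 * s + s ^ 2 / F := by field_simp; ring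
      linarith
    have h5 : (F - s) ^ 2 ≤ 0 := by
      rwa [div_le_iff₀ hFpos, zero_mul] at h4
    have := pow_eq_zero_iff (two_ne_zero) |>.1 (le_antisymm h5 (sq_nonneg _))
    linarith
  have henergy : ∫ t, (c t / s) ^ 2 ∂ν = 1 / s := by
    simp only [div_pow]
    rw [integral_div, ← hF, hFs]
    field_simp
  refine ⟨fun t => c t / s, 1 / a / s, fun x y h => div_le_div_of_nonneg_right (hc h) hs0.le,
    fun t => ⟨div_nonneg (hcb t).1 hs0.le, div_le_div_of_nonneg_right (hcb t).2 hs0.le⟩, ?_, ?_,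
    fun d M hd hdb => ?_⟩
  · rw [integral_div, ← hs, div_self hs0.ne']
  · rw [henergy]; positivity
  · rw [henergy]
    set D := ∫ t, d t ∂μ with hD
    have hD0 : 0 ≤ D := integral_nonneg fun t => (hdb t).1
    rcases hD0.eq_or_lt with h | h
    · rw [← h]
      simpa using integral_nonneg (μ := ν) fun t => sq_nonneg (d t)
    · have h1 := hscale d M hd hdb (s / D) (by positivity)
      rw [← hD, hFs, div_mul_cancel₀ _ h.ne'] at h1
      have h2 : s ≤ (s / D) ^ 2 * ∫ t, d t ^ 2 ∂ν := by linarith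
      have h3 : 1 / s * D ^ 2 * s ≤ (∫ t, d t ^ 2 ∂ν) * s := by
        calc 1 / s * D ^ 2 * s = D ^ 2 / s * s := by field_simp
          _ ≤ D ^ 2 / s * ((s / D) ^ 2 * ∫ t, d t ^ 2 ∂ν) := by gcongr
          _ = (∫ t, d t ^ 2 ∂ν) * s := by field_simp
      exact le_of_mul_le_mul_right h3 hs0

end Profiles

/-! ### Subgradients and information rents -/

/-- A function with decreasing slopes `-g` (in the sense of subgradients) is recovered from them. -/
theorem integral_eq_sub_of_subgradient {g w : ℝ → ℝ} {a b : ℝ} (hab : a ≤ b) (hg : Antitone g)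
    (hw : ∀ x ∈ Set.Icc a b, ∀ y ∈ Set.Icc a b, (y - x) * g y ≤ w x - w y) :
    ∫ x in a..b, g x = w a - w b := by
  have hcont : ContinuousOn w (Set.Icc a b) := by
    set K := max |g a| |g b| with hK
    have hgK : ∀ x ∈ Set.Icc a b, |g x| ≤ K := fun x hx =>
      (abs_le_max_abs_abs (hg hx.2) (hg hx.1)).trans_eq (max_comm _ _)
    have hle : ∀ x ∈ Set.Icc a b, ∀ y ∈ Set.Icc a b, w y - w x ≤ K * |x - y| := by
      intro x hx y hy
      have h1 := hw x hx y hy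
      have h2 : -((y - x) * g y) ≤ K * |x - y| := by
        calc -((y - x) * g y) ≤ |(y - x) * g y| := neg_le_abs _
          _ = |g y| * |x - y| := by rw [abs_mul, abs_sub_comm, mul_comm]
          _ ≤ K * |x - y| := by gcongr; exact hgK y hy
      linarith
    refine (LipschitzOnWith.of_dist_le_mul (K := K.toNNReal) fun x hx y hy => ?_).continuousOn
    rw [Real.dist_eq, Real.dist_eq, Real.coe_toNNReal _ (le_max_of_le_left (abs_nonneg _)),
      abs_le]
    constructor
    · linarith [hle x hx y hy]
    · have := hle y hy x hx
      rwa [abs_sub_comm] at this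
  -- The two subgradient inequalities squeeze `w x - w y` between `(y - x) g y` and `(y - x) g x`,
  -- so continuity of `g` at `x` suffices; a monotone `g` is discontinuous at countably many points
  -- only.
  have hderiv : ∀ x ∈ Set.Ioo a b \ {x | ¬ContinuousAt g x}, HasDerivAt (fun y => -w y) (g x) x := by
    rintro x ⟨hx, hgx⟩
    replace hgx : ContinuousAt g x := by simpa using hgx
    rw [hasDerivAt_iff_isLittleO, Asymptotics.isLittleO_iff]
    intro ε hε
    filter_upwards [Ioo_mem_nhds hx.1 hx.2, Metric.continuousAt_iff'.1 hgx ε hε] with y hy hgy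
    have h1 := hw y ⟨hy.1.le, hy.2.le⟩ x ⟨hx.1.le, hx.2.le⟩
    have h2 := hw x ⟨hx.1.le, hx.2.le⟩ y ⟨hy.1.le, hy.2.le⟩
    rw [Real.dist_eq] at hgy
    rw [Real.norm_eq_abs, Real.norm_eq_abs, smul_eq_mul]
    have h3 : |(y - x) * (g y - g x)| ≤ ε * |y - x| := by
      rw [abs_mul, mul_comm]
      gcongr
    have h4 := abs_le.1 h3
    rw [abs_le]
    constructor <;> nlinarith [abs_nonneg (y - x)]
  rw [integral_eq_of_hasDerivAt_off_countable_of_le (fun y => -w y) g hab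
    hg.countable_not_continuousAt hcont.neg hderiv hg.intervalIntegrable]
  ring

/-- The information rent `∫_θ^1 q(s) ds` of type `θ` when the claims have variances `q`. -/
def rent {a : ℝ} (ha1 : a ≤ 1) (q : Set.Icc a 1 → ℝ) (θ : Set.Icc a 1) : ℝ :=
  ∫ s in (θ : ℝ)..1, Set.IccExtend ha1 q s

theorem antitone_IccExtend {a : ℝ} (ha1 : a ≤ 1) {q : Set.Icc a 1 → ℝ} (hq : Antitone q) :
    Antitone (Set.IccExtend ha1 q) :=
  hq.comp_monotone (Set.monotone_projIcc ha1)

/-- The right side integrates the decreasing `q` from `θ` to `θ'`, the left side its value at `θ'`.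
This is incentive compatibility for a catalogue that leaves each type its rent. -/
theorem mul_le_rent_sub_rent {a : ℝ} (ha1 : a ≤ 1) {q : Set.Icc a 1 → ℝ} (hq : Antitone q)
    (θ θ' : Set.Icc a 1) : ((θ' : ℝ) - θ) * q θ' ≤ rent ha1 q θ - rent ha1 q θ' := by
  have hg := antitone_IccExtend ha1 hq
  have hi : ∀ x y : ℝ, IntervalIntegrable (Set.IccExtend ha1 q) volume x y := fun x y =>
    hg.intervalIntegrable
  have h1 : rent ha1 q θ - rent ha1 q θ' = ∫ s in (θ : ℝ)..θ', Set.IccExtend ha1 q s := by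
    rw [rent, rent, ← intervalIntegral.integral_add_adjacent_intervals (hi θ θ') (hi θ' 1)]
    ring
  have hθ' : Set.IccExtend ha1 q θ' = q θ' := Set.IccExtend_val ha1 q θ'
  rw [h1, ← hθ']
  rcases le_total (θ : ℝ) θ' with h | h
  · have := intervalIntegral.integral_mono_on (f := fun _ => Set.IccExtend ha1 q θ') h
      intervalIntegrable_const (hi θ θ') (fun x hx => hg hx.2)
    simpa using this
  · have := intervalIntegral.integral_mono_on (g := fun _ => Set.IccExtend ha1 q θ') h
      (hi θ' θ) intervalIntegrable_const (fun x hx => hg hx.1)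
    rw [intervalIntegral.integral_symm]
    simp only [intervalIntegral.integral_const, smul_eq_mul] at this
    linarith

theorem rent_nonneg {a : ℝ} (ha1 : a ≤ 1) {q : Set.Icc a 1 → ℝ} (hq : ∀ θ, 0 ≤ q θ)
    (θ : Set.Icc a 1) : 0 ≤ rent ha1 q θ :=
  intervalIntegral.integral_nonneg θ.2.2 fun _ _ => hq _

/-- Nonnegative indirect utilities are at least the information rent. -/
theorem rent_le_of_subgradient {a : ℝ} (ha1 : a ≤ 1) {q v : Set.Icc a 1 → ℝ} (hq : Antitone q)
    (hv : ∀ θ θ' : Set.Icc a 1, ((θ' : ℝ) - θ) * q θ' ≤ v θ - v θ') (hv0 : ∀ θ, 0 ≤ v θ)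
    (θ : Set.Icc a 1) : rent ha1 q θ ≤ v θ := by
  have h := integral_eq_sub_of_subgradient (w := Set.IccExtend ha1 v) θ.2.2
    (antitone_IccExtend ha1 hq) fun x hx y hy => by
      have hx' : x ∈ Set.Icc a 1 := ⟨θ.2.1.trans hx.1, hx.2⟩
      have hy' : y ∈ Set.Icc a 1 := ⟨θ.2.1.trans hy.1, hy.2⟩
      rw [Set.IccExtend_of_mem ha1 q hy', Set.IccExtend_of_mem ha1 v hy',
        Set.IccExtend_of_mem ha1 v hx']
      exact hv ⟨x, hx'⟩ ⟨y, hy'⟩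
  rw [rent, h, Set.IccExtend_val, Set.IccExtend_right]
  linarith [hv0 ⟨1, Set.right_mem_Icc.2 ha1⟩]

/-! ### The cost measure -/

/-- The measure against which a variance profile `q` is integrated to give the principal's cost
`∫ (θ q(θ) + ∫_θ^1 q(s) ds) dμ(θ)`. -/
def costMeasure {a : ℝ} (ha1 : a ≤ 1) (μ : Measure (Set.Icc a 1)) : Measure (Set.Icc a 1) :=
  μ.withDensity (fun θ => ENNReal.ofReal θ) +
    ((μ.prod (volume.restrict (Set.Ioc a 1))).restrict {p | (p.1 : ℝ) < p.2}).map
      (fun p => Set.projIcc a 1 ha1 p.2)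

/-- The first summand has density `θ ≥ a`. For `a > 0` this is the coercivity behind the optimal
profile. -/
theorem smul_le_costMeasure {a : ℝ} (ha1 : a ≤ 1) (μ : Measure (Set.Icc a 1)) :
    ENNReal.ofReal a • μ ≤ costMeasure ha1 μ := by
  rw [← withDensity_const]
  exact (withDensity_mono (ae_of_all _ fun θ => ENNReal.ofReal_le_ofReal θ.2.1)).trans
    (Measure.le_add_right le_rfl)

theorem isFiniteMeasure_withDensity_type {a : ℝ} (μ : Measure (Set.Icc a 1))
    [IsFiniteMeasure μ] :
    IsFiniteMeasure (μ.withDensity (fun θ => ENNReal.ofReal θ)) := by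
  refine isFiniteMeasure_withDensity (ne_of_lt ?_)
  calc ∫⁻ θ : Set.Icc a 1, ENNReal.ofReal θ ∂μ ≤ ∫⁻ _, 1 ∂μ :=
        lintegral_mono fun θ => ENNReal.ofReal_le_one.2 θ.2.2
    _ < ⊤ := by simp

instance isFiniteMeasure_costMeasure {a : ℝ} (ha1 : a ≤ 1) (μ : Measure (Set.Icc a 1))
    [IsFiniteMeasure μ] : IsFiniteMeasure (costMeasure ha1 μ) := by
  have := isFiniteMeasure_withDensity_type μ
  unfold costMeasure
  infer_instance

/-- Fubini on the triangle `θ < s ≤ 1`: the second summand of `costMeasure` integrates `q s` over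
it, and integrating in `s` first gives the rent. -/
theorem integral_costMeasure {a : ℝ} (ha : 0 ≤ a) (ha1 : a ≤ 1) (μ : Measure (Set.Icc a 1))
    [IsFiniteMeasure μ] {q : Set.Icc a 1 → ℝ} {M : ℝ} (hq : Antitone q)
    (hqb : ∀ θ, q θ ∈ Set.Icc 0 M) :
    Integrable (rent ha1 q) μ ∧
      ∫ θ, q θ ∂(costMeasure ha1 μ) = ∫ θ, ((θ : ℝ) * q θ + rent ha1 q θ) ∂μ := by
  have := isFiniteMeasure_withDensity_type μ
  have hproj : Measurable fun p : Set.Icc a 1 × ℝ => Set.projIcc a 1 ha1 p.2 :=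
    continuous_projIcc.measurable.comp measurable_snd
  have hset : MeasurableSet {p : Set.Icc a 1 × ℝ | (p.1 : ℝ) < p.2} :=
    measurableSet_lt (measurable_subtype_coe.comp measurable_fst) measurable_snd
  have hqi : ∀ m : Measure (Set.Icc a 1), IsFiniteMeasure m → Integrable q m := fun m _ =>
    integrable_of_antitone hq hqb
  have hint : Integrable ({p : Set.Icc a 1 × ℝ | (p.1 : ℝ) < p.2}.indicator
      fun p => q (Set.projIcc a 1 ha1 p.2)) (μ.prod (volume.restrict (Set.Ioc a 1))) := by
    refine Integrable.indicator ?_ hset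
    exact Integrable.of_mem_Icc 0 M (hq.measurable.comp hproj).aemeasurable
      (ae_of_all _ fun p => hqb _)
  have hinner : ∀ θ : Set.Icc a 1, ∫ s in Set.Ioc a 1,
      {p : Set.Icc a 1 × ℝ | (p.1 : ℝ) < p.2}.indicator
        (fun p => q (Set.projIcc a 1 ha1 p.2)) (θ, s) = rent ha1 q θ := by
    intro θ
    have h1 : (fun s : ℝ => {p : Set.Icc a 1 × ℝ | (p.1 : ℝ) < p.2}.indicator
        (fun p => q (Set.projIcc a 1 ha1 p.2)) (θ, s))
        = (Set.Ioi (θ : ℝ)).indicator (Set.IccExtend ha1 q) := by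
      ext s
      simp only [Set.indicator, Set.mem_ofPred_eq, Set.mem_Ioi, Set.IccExtend_apply]
      rfl
    rw [h1, setIntegral_indicator measurableSet_Ioi, rent, intervalIntegral.integral_of_le θ.2.2]
    congr 2
    ext s
    simp only [Set.mem_inter_iff, Set.mem_Ioc, Set.mem_Ioi]
    exact ⟨fun h => ⟨h.2, h.1.2⟩, fun h => ⟨⟨θ.2.1.trans_lt h.1, h.2⟩, h.1⟩⟩
  have hrent : Integrable (rent ha1 q) μ := by
    have := hint.integral_prod_left
    simpa only [hinner] using this
  refine ⟨hrent, ?_⟩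
  have hθq : Integrable (fun θ : Set.Icc a 1 => (θ : ℝ) * q θ) μ := by
    refine (hqi μ inferInstance).bdd_mul (c := 1) measurable_subtype_coe.aestronglyMeasurable
      (ae_of_all _ fun θ => ?_)
    rw [Real.norm_of_nonneg (ha.trans θ.2.1)]
    exact θ.2.2
  rw [costMeasure, integral_add_measure (hqi _ inferInstance) (hqi _ inferInstance),
    integral_add hθq hrent, integral_map hproj.aemeasurable hq.measurable.aestronglyMeasurable,
    ← integral_indicator hset, integral_prod _ hint]
  congr 1
  · rw [integral_withDensity_eq_integral_toReal_smul
      (by fun_prop) (ae_of_all _ fun _ => ENNReal.ofReal_lt_top)]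
    refine integral_congr_ae (ae_of_all _ fun θ => ?_)
    simp [ENNReal.toReal_ofReal (ha.trans θ.2.1)]
  · simp only [hinner]

/-! ### Integral inequalities in `L²` -/

/-- Cauchy-Schwarz for square integrable functions. -/
theorem integral_mul_le_sqrt_mul_sqrt {Ω : Type*} [MeasurableSpace Ω] {P : Measure Ω}
    {f g : Ω → ℝ} (hf : MemLp f 2 P) (hg : MemLp g 2 P) :
    ∫ ω, f ω * g ω ∂P ≤ √(∫ ω, f ω ^ 2 ∂P) * √(∫ ω, g ω ^ 2 ∂P) := by
  have h := real_inner_le_norm (hf.toLp f) (hg.toLp g)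
  rw [← sq_norm_eq_integral_of_ae_eq hf.coeFn_toLp, ← sq_norm_eq_integral_of_ae_eq hg.coeFn_toLp,
    Real.sqrt_sq (norm_nonneg _), Real.sqrt_sq (norm_nonneg _)]
  refine le_of_eq_of_le ?_ h
  rw [L2.inner_def]
  refine integral_congr_ae ?_
  filter_upwards [hf.coeFn_toLp, hg.coeFn_toLp] with ω h1 h2
  simp [h1, h2, mul_comm]

/-- Minkowski's integral inequality in `L²`. -/
theorem integral_sq_average_le {Ω T : Type*} [MeasurableSpace Ω] [MeasurableSpace T]
    {P : Measure Ω} [IsFiniteMeasure P] {μ : Measure T} [IsFiniteMeasure μ] {f : Ω × T → ℝ}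
    {d : T → ℝ} (hf : MemLp f 2 (P.prod μ)) (hft : ∀ t, MemLp (fun ω => f (ω, t)) 2 P)
    (hd : Integrable d μ) (hfd : ∀ t, √(∫ ω, f (ω, t) ^ 2 ∂P) ≤ d t) :
    ∫ ω, (∫ t, f (ω, t) ∂μ) ^ 2 ∂P ≤ (∫ t, d t ∂μ) ^ 2 := by
  set Z : Ω → ℝ := fun ω => ∫ t, f (ω, t) ∂μ with hZdef
  have hZ : MemLp Z 2 P := memLp_average hf
  set A := ∫ ω, Z ω ^ 2 ∂P with hA
  have hA0 : 0 ≤ A := integral_nonneg fun _ => sq_nonneg _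
  have hint : Integrable (fun p : Ω × T => Z p.1 * f p) (P.prod μ) :=
    (hZ.comp_fst μ).integrable_mul hf
  -- Expand one factor of `Z²` and exchange the integrals; Cauchy-Schwarz for each `t` then bounds
  -- `A` by `√A ∫ d dμ`, and `√A` cancels.
  have h1 : A = ∫ t, ∫ ω, Z ω * f (ω, t) ∂P ∂μ := by
    rw [← integral_integral_swap (f := fun ω t => Z ω * f (ω, t)) hint]
    simp only [integral_const_mul]
    refine integral_congr_ae (ae_of_all _ fun ω => ?_)
    simp only [hZdef]
    ring
  have h2 : A ≤ √A * ∫ t, d t ∂μ := by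
    conv_lhs => rw [h1]
    rw [← integral_const_mul]
    refine integral_mono hint.integral_prod_right (hd.const_mul _) fun t => ?_
    exact (integral_mul_le_sqrt_mul_sqrt hZ (hft t)).trans
      (mul_le_mul_of_nonneg_left (hfd t) (Real.sqrt_nonneg _))
  rcases hA0.eq_or_lt with h | h
  · rw [← h]; positivity
  · have h3 : 0 < √A := Real.sqrt_pos.2 h
    have h4 : √A * √A ≤ √A * ∫ t, d t ∂μ := by rwa [Real.mul_self_sqrt hA0]
    have h5 := le_of_mul_le_mul_left h4 h3
    calc A = √A ^ 2 := (Real.sq_sqrt hA0).symm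
      _ ≤ _ := by gcongr

/-! ### Centred claims and the reduced problem -/

variable {Ω : Type*} [MeasurableSpace Ω]

/-- The mean zero claims in `L²(P)` that are written on `W`. -/
def centredClaims (P : Measure Ω) (W : Ω → ℝ) : Set (Lp ℝ 2 P) :=
  {Z | AEStronglyMeasurable[MeasurableSpace.comap W inferInstance] Z P ∧ ∫ ω, Z ω ∂P = 0}

theorem isClosed_centredClaims {P : Measure Ω} [IsFiniteMeasure P] {W : Ω → ℝ}
    (hW : Measurable W) : IsClosed (centredClaims P W) := by
  refine (isClosed_aestronglyMeasurable hW.comap_le).inter ?_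
  have h : (fun Z : Lp ℝ 2 P => ∫ ω, Z ω ∂P) = fun Z => inner ℝ (Lp.const 2 P (1 : ℝ)) Z := by
    ext Z
    rw [L2.inner_def]
    refine integral_congr_ae ?_
    filter_upwards [Lp.coeFn_const (p := 2) (μ := P) (1 : ℝ)] with ω hω
    rw [hω]
    simp
  have hc : Continuous fun Z : Lp ℝ 2 P => ∫ ω, Z ω ∂P := by
    rw [h]
    fun_prop
  exact isClosed_singleton.preimage hc

theorem integrable_coe_Lp_two {P : Measure Ω} [IsFiniteMeasure P] (Z : Lp ℝ 2 P) :
    Integrable Z P :=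
  (Lp.memLp Z).integrable (by norm_num)

theorem convex_centredClaims (P : Measure Ω) [IsFiniteMeasure P] (W : Ω → ℝ) :
    Convex ℝ (centredClaims P W) := by
  rintro Y ⟨hYm, hY⟩ Z ⟨hZm, hZ⟩ s t - - -
  have h : ((s • Y + t • Z : Lp ℝ 2 P) : Ω → ℝ) =ᵐ[P] fun ω => s * Y ω + t * Z ω := by
    filter_upwards [Lp.coeFn_add (s • Y) (t • Z), Lp.coeFn_smul s Y, Lp.coeFn_smul t Z]
      with ω h1 h2 h3
    rw [h1, Pi.add_apply, h2, h3]
    rfl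
  refine ⟨?_, ?_⟩
  · exact ((hYm.const_smul s).add (hZm.const_smul t)).congr h.symm
  · rw [integral_congr_ae h, integral_add ((integrable_coe_Lp_two Y).const_mul s)
      ((integrable_coe_Lp_two Z).const_mul t), integral_const_mul, integral_const_mul, hY, hZ]
    simp

theorem zero_mem_centredClaims (P : Measure Ω) (W : Ω → ℝ) : 0 ∈ centredClaims P W := by
  refine ⟨?_, ?_⟩
  · exact aestronglyMeasurable_const.congr (Lp.coeFn_zero ℝ 2 P).symm
  · rw [integral_congr_ae (Lp.coeFn_zero ℝ 2 P)]
    simp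

/-- A lower semicontinuous convex functional plus a positive multiple of the squared norm attains
its minimum on a closed convex set. -/
theorem exists_min_risk_add_sq_norm {P : Measure Ω} [IsProbabilityMeasure P]
    {ρ : Lp ℝ 2 P → EReal} (hcoh : IsCoherent ρ) (hfatou : HasFatouProperty ρ)
    {K : Set (Lp ℝ 2 P)} (hK : IsClosed K) (hKc : Convex ℝ K) (hKne : K.Nonempty)
    (w : Lp ℝ 2 P) {κ : ℝ} (hκ : 0 < κ) :
    ∃ Z ∈ K, ∀ Z' ∈ K, ρ (w - Z) + ((κ * ‖Z‖ ^ 2 : ℝ) : EReal)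
      ≤ ρ (w - Z') + ((κ * ‖Z'‖ ^ 2 : ℝ) : EReal) := by
  by_cases htop : ∀ Z ∈ K, ρ (w - Z) = ⊤
  · obtain ⟨Z, hZ⟩ := hKne
    exact ⟨Z, hZ, fun Z' hZ' => by
      rw [htop Z' hZ', EReal.top_add_coe]
      exact le_top⟩
  push Not at htop
  obtain ⟨Z₀, hZ₀, hfin⟩ := htop
  -- This epigraph turns the extended-valued problem into a real one: the Fatou property makes it
  -- closed, and finiteness of `ρ (w - Z₀)` bounds the vertical line through `Z₀` from below.
  set S : Set (Lp ℝ 2 P × ℝ) := {p | p.1 ∈ K ∧ ρ (w - p.1) ≤ (p.2 : EReal)} with hSdef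
  have hS : IsClosed S := by
    refine IsSeqClosed.isClosed fun p q hp hq => ?_
    have h1 : Tendsto (fun n => (p n).1) atTop (𝓝 q.1) := (continuous_fst.tendsto _).comp hq
    have h2 : Tendsto (fun n => (p n).2) atTop (𝓝 q.2) := (continuous_snd.tendsto _).comp hq
    refine ⟨hK.mem_of_tendsto h1 (Eventually.of_forall fun n => (hp n).1), ?_⟩
    refine (hfatou (fun n => w - (p n).1) _ (h1.const_sub w)).trans ?_
    refine (liminf_le_liminf (Eventually.of_forall fun n => (hp n).2)).trans ?_
    exact ((continuous_coe_real_ereal.tendsto _).comp h2).liminf_eq.le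
  have hconv : Convex ℝ S := by
    rintro p ⟨hpK, hp⟩ q ⟨hqK, hq⟩ s t hs ht hst
    refine ⟨hKc hpK hqK hs ht hst, ?_⟩
    have ht' : t = 1 - s := by linarith
    subst ht'
    have h1 : w - (s • p + (1 - s) • q).1 = s • (w - p.1) + (1 - s) • (w - q.1) := by
      simp only [Prod.fst_add, Prod.smul_fst]
      module
    rw [h1]
    refine (hcoh.convex _ _ s hs (by linarith)).trans ?_
    have h2 : ((s • p + (1 - s) • q).2 : EReal)
        = (s : EReal) * p.2 + ((1 - s : ℝ) : EReal) * q.2 := by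
      simp only [Prod.snd_add, Prod.smul_snd, smul_eq_mul]
      norm_cast
    rw [h2]
    have hs' : (0 : EReal) ≤ s := by exact_mod_cast hs
    have ht' : (0 : EReal) ≤ ((1 - s : ℝ) : EReal) := by exact_mod_cast ht
    exact add_le_add (mul_le_mul_of_nonneg_left hp hs') (mul_le_mul_of_nonneg_left hq ht')
  obtain ⟨r₀, hr₀⟩ : ∃ r : ℝ, (r : EReal) = ρ (w - Z₀) :=
    ⟨_, EReal.coe_toReal hfin (hcoh.ne_bot _)⟩
  have h₀ : (Z₀, r₀) ∈ S := ⟨hZ₀, hr₀.ge⟩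
  have h₁ : (Z₀, r₀ - 1) ∉ S := fun h => by
    have h2 := h.2
    simp only [← hr₀, EReal.coe_le_coe_iff] at h2
    linarith
  obtain ⟨p, ⟨hpK, hp⟩, hmin⟩ := exists_isMinOn_add_sq_norm hS hconv hκ one_pos h₀ h₁
  refine ⟨p.1, hpK, fun Z' hZ' => ?_⟩
  by_cases hZ't : ρ (w - Z') = ⊤
  · rw [hZ't, EReal.top_add_coe]
    exact le_top
  obtain ⟨r, hr⟩ : ∃ r : ℝ, (r : EReal) = ρ (w - Z') :=
    ⟨_, EReal.coe_toReal hZ't (hcoh.ne_bot _)⟩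
  have h2 := hmin (Z', r) ⟨hZ', hr.ge⟩
  rw [← hr]
  calc ρ (w - p.1) + ((κ * ‖p.1‖ ^ 2 : ℝ) : EReal)
      ≤ (p.2 : EReal) + ((κ * ‖p.1‖ ^ 2 : ℝ) : EReal) := by gcongr
    _ ≤ (r : EReal) + ((κ * ‖Z'‖ ^ 2 : ℝ) : EReal) := by exact_mod_cast h2

/-! ### From catalogues to centred claims and back -/

section Catalogues

variable {P : Measure Ω} [IsProbabilityMeasure P] {W : Ω → ℝ} {a : ℝ}
  {μ : Measure (Set.Icc a 1)} [IsFiniteMeasure μ] {ρ : Lp ℝ 2 P → EReal}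

theorem isSolution_of_forall_le {hW : MemLp W 2 P} {C : Catalogue P W a μ}
    (hC : C ∈ feasible P W a μ) (hle : ∀ C' ∈ feasible P W a μ, C.risk ρ hW ≤ C'.risk ρ hW) :
    IsSolution ρ hW C :=
  ⟨hC, le_antisymm (le_iInf₂ hle) (iInf₂_le C hC)⟩

theorem Catalogue.risk_eq_add (hcoh : IsCoherent ρ) (hW : MemLp W 2 P) (C : Catalogue P W a μ)
    (Z : Lp ℝ 2 P) (r : ℝ) (h : C.position =ᵐ[P] fun ω => W ω - Z ω - r) :
    C.risk ρ hW = ρ (hW.toLp W - Z) + (r : EReal) := by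
  have h1 : (C.memLp_position hW).toLp C.position = (hW.toLp W - Z) + Lp.const 2 P (-r) := by
    refine Lp.ext ?_
    filter_upwards [h, (C.memLp_position hW).coeFn_toLp, hW.coeFn_toLp,
      Lp.coeFn_add (hW.toLp W - Z) (Lp.const 2 P (-r)), Lp.coeFn_sub (hW.toLp W) Z,
      Lp.coeFn_const (p := 2) (μ := P) (-r)] with ω h1 h2 h3 h4 h5 h6
    rw [h2, h1, h4, Pi.add_apply, h5, Pi.sub_apply, h3, h6]
    simp
    ring
  rw [Catalogue.risk, h1, hcoh.cash_invariant, EReal.coe_neg, sub_eq_add_neg, neg_neg]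

/-- The claims `c(θ) Z` with a bounded decreasing profile `c` of unit mass are part of an admissible
catalogue whose cost is governed by the energy of `c`. -/
theorem exists_catalogue_of_profile (hcoh : IsCoherent ρ)
    (hW : MemLp W 2 P) (ha : 0 ≤ a) (ha1 : a ≤ 1) {Z : Lp ℝ 2 P} (hZ : Z ∈ centredClaims P W)
    {c : Set.Icc a 1 → ℝ} {M : ℝ} (hc : Antitone c) (hcb : ∀ θ, c θ ∈ Set.Icc 0 M)
    (hc1 : ∫ θ, c θ ∂μ = 1) :
    ∃ C ∈ feasible P W a μ, C.risk ρ hW = ρ (hW.toLp W - Z) +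
      (((∫ θ, c θ ^ 2 ∂(costMeasure ha1 μ)) * ‖Z‖ ^ 2 : ℝ) : EReal) := by
  -- A catalogue must be jointly measurable for `σ(W)` itself, so the class `Z` is replaced by a
  -- version `z` that is strictly `σ(W)`-measurable.
  obtain ⟨⟨z, hz, hzZ⟩, hZ0⟩ := hZ
  have hzm : Measurable[MeasurableSpace.comap W inferInstance] z := hz.measurable
  have hzL : MemLp z 2 P := (Lp.memLp Z).ae_eq hzZ
  have hz0 : ∫ ω, z ω ∂P = 0 := by rw [← hZ0, integral_congr_ae hzZ]
  set A := ‖Z‖ ^ 2 with hA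
  have hzA : ∫ ω, z ω ^ 2 ∂P = A := (sq_norm_eq_integral_of_ae_eq hzZ).symm
  have hA0 : 0 ≤ A := by positivity
  have hq := antitone_sq hc hcb
  have hqb := sq_mem_Icc hcb
  obtain ⟨hrent, hcost⟩ := integral_costMeasure ha ha1 μ hq hqb
  have hq2 := integrable_sq_of_antitone (μ := μ) hc hcb
  have hci := integrable_of_antitone (μ := μ) hc hcb
  have hθq : Integrable (fun θ : Set.Icc a 1 => (θ : ℝ) * c θ ^ 2) μ := by
    refine hq2.bdd_mul (c := 1) measurable_subtype_coe.aestronglyMeasurable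
      (ae_of_all _ fun θ => ?_)
    rw [Real.norm_of_nonneg (ha.trans θ.2.1)]
    exact θ.2.2
  have hπi : Integrable (fun θ : Set.Icc a 1 =>
      -A * ((θ : ℝ) * c θ ^ 2 + rent ha1 (fun θ => c θ ^ 2) θ)) μ :=
    (hθq.add hrent).const_mul (-A)
  let C : Catalogue P W a μ :=
    { X := fun θ ω => c θ * z ω
      -- Type `θ` values its claim at `-θ c(θ)² A`, so this price leaves it exactly its rent, scaled
      -- by the variance `A` of `z`.
      π := fun θ => -A * ((θ : ℝ) * c θ ^ 2 + rent ha1 (fun θ => c θ ^ 2) θ)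
      measurable_X := by
        refine Measurable.mul (hc.measurable.comp ?_) (hzm.comp ?_)
        · exact @measurable_snd _ _ (MeasurableSpace.comap W inferInstance) _
        · exact @measurable_fst _ _ (MeasurableSpace.comap W inferInstance) _
      memLp_X := by
        refine ((hzL.comp_fst μ).const_mul M).of_le
          ((hc.measurable.comp measurable_snd).aestronglyMeasurable.mul
            (hzL.comp_fst μ).aestronglyMeasurable) (ae_of_all _ fun p => ?_)
        rw [norm_mul, norm_mul, Real.norm_of_nonneg (hcb p.2).1,
          Real.norm_of_nonneg ((hcb p.2).1.trans (hcb p.2).2)]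
        exact mul_le_mul_of_nonneg_right (hcb p.2).2 (norm_nonneg _)
      memLp_claim := fun θ => hzL.const_mul _
      integrable_π := hπi }
  have hU : ∀ θ θ' : Set.Icc a 1, utility P θ (C.X θ') = -((θ : ℝ) * (c θ' ^ 2 * A)) := by
    intro θ θ'
    have h1 : variance z P = A := by
      rw [variance_of_integral_eq_zero hzL.aestronglyMeasurable.aemeasurable hz0, ← hzA]
    have h2 : variance (C.X θ') P = c θ' ^ 2 * A := by
      change variance (fun ω => c θ' * z ω) P = _
      rw [variance_const_mul, h1]
    have h3 : ∫ ω, C.X θ' ω ∂P = 0 := by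
      change ∫ ω, c θ' * z ω ∂P = 0
      rw [integral_const_mul, hz0, mul_zero]
    rw [utility, h2, h3, zero_sub]
  have hUπ : ∀ θ : Set.Icc a 1, utility P θ (C.X θ) - C.π θ = A * rent ha1 (fun θ => c θ ^ 2) θ := by
    intro θ
    rw [hU]
    change _ - -A * ((θ : ℝ) * c θ ^ 2 + rent ha1 (fun θ => c θ ^ 2) θ) = _
    ring
  refine ⟨C, ⟨fun θ θ' => ?_, fun θ => ?_⟩, C.risk_eq_add hcoh hW Z _ ?_⟩
  · rw [hUπ, hU]
    change _ - -A * ((θ' : ℝ) * c θ' ^ 2 + rent ha1 (fun θ => c θ ^ 2) θ') ≤ _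
    have := mul_le_mul_of_nonneg_left (mul_le_rent_sub_rent ha1 hq θ θ') hA0
    linarith
  · rw [hUπ]
    exact mul_nonneg hA0 (rent_nonneg ha1 (fun θ => (hqb θ).1) θ)
  · filter_upwards [hzZ] with ω hω
    have h1 : C.position ω = W ω + ∫ θ : Set.Icc a 1,
        (-A * ((θ : ℝ) * c θ ^ 2 + rent ha1 (fun θ => c θ ^ 2) θ) - c θ * z ω) ∂μ := rfl
    rw [h1, integral_sub hπi (hci.mul_const _), integral_const_mul, integral_mul_const, hc1,
      ← hcost, hω]
    ring

/-- The risk of an admissible catalogue is at least that of a centred claim plus a multiple of its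
variance. -/
theorem exists_centredClaim_le_risk (hcoh : IsCoherent ρ) (hWm : Measurable W)
    (hW : MemLp W 2 P) (ha : 0 ≤ a) (ha1 : a ≤ 1) {κ : ℝ} (hκ : 0 ≤ κ)
    (hopt : ∀ (d : Set.Icc a 1 → ℝ) (M : ℝ), Antitone d → (∀ θ, d θ ∈ Set.Icc 0 M) →
      κ * (∫ θ, d θ ∂μ) ^ 2 ≤ ∫ θ, d θ ^ 2 ∂(costMeasure ha1 μ))
    {C : Catalogue P W a μ} (hC : C ∈ feasible P W a μ) :
    ∃ Z ∈ centredClaims P W,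
      ρ (hW.toLp W - Z) + ((κ * ‖Z‖ ^ 2 : ℝ) : EReal) ≤ C.risk ρ hW := by
  obtain ⟨hic, hir⟩ := hC
  set m : Set.Icc a 1 → ℝ := fun θ => ∫ ω, C.X θ ω ∂P with hm
  set q : Set.Icc a 1 → ℝ := fun θ => variance (C.X θ) P with hq
  set v : Set.Icc a 1 → ℝ := fun θ => utility P θ (C.X θ) - C.π θ with hv
  have hsub : ∀ θ θ' : Set.Icc a 1, ((θ' : ℝ) - θ) * q θ' ≤ v θ - v θ' := by
    intro θ θ'
    have := hic θ θ'
    simp only [hv, hq, utility] at this ⊢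
    linarith
  have hqa : Antitone q := by
    intro θ θ' h
    rcases h.eq_or_lt with rfl | h
    · exact le_rfl
    have h' : (0 : ℝ) < (θ' : ℝ) - θ := sub_pos.2 h
    -- Adding the incentive constraints of the two types eliminates `v`.
    have h1 : ((θ' : ℝ) - θ) * q θ' ≤ ((θ' : ℝ) - θ) * q θ := by
      linarith [hsub θ θ', hsub θ' θ]
    exact le_of_mul_le_mul_left h1 h'
  have hqb : ∀ θ, q θ ∈ Set.Icc 0 (q ⟨a, Set.left_mem_Icc.2 ha1⟩) := fun θ =>
    ⟨variance_nonneg _ _, hqa θ.2.1⟩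
  have hda : Antitone fun θ => √(q θ) := fun θ θ' h => Real.sqrt_le_sqrt (hqa h)
  have hdb : ∀ θ, √(q θ) ∈ Set.Icc 0 √(q ⟨a, Set.left_mem_Icc.2 ha1⟩) := fun θ =>
    ⟨Real.sqrt_nonneg _, Real.sqrt_le_sqrt (hqb θ).2⟩
  obtain ⟨hrent, hcost⟩ := integral_costMeasure ha ha1 μ hqa hqb
  have hXm : Measurable fun p : Ω × Set.Icc a 1 => C.X p.2 p.1 :=
    C.measurable_X.mono (sup_le_sup (MeasurableSpace.comap_mono hWm.comap_le) le_rfl) le_rfl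
  have hmL : MemLp m 2 μ := by
    have : MemLp (fun p : Set.Icc a 1 × Ω => C.X p.1 p.2) 2 (μ.prod P) :=
      C.memLp_X.comp_measurePreserving Measure.measurePreserving_swap
    exact memLp_average this
  have hmm : Measurable m := (hXm.stronglyMeasurable.integral_prod_left').measurable
  have hmi : Integrable m μ := hmL.integrable (by norm_num)
  have hfL : MemLp (fun p : Ω × Set.Icc a 1 => C.X p.2 p.1 - m p.2) 2 (P.prod μ) :=
    C.memLp_X.sub (hmL.comp_snd P)
  have hft : ∀ θ, MemLp (fun ω => C.X θ ω - m θ) 2 P := fun θ =>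
    (C.memLp_claim θ).sub (memLp_const _)
  set z : Ω → ℝ := fun ω => ∫ θ, (C.X θ ω - m θ) ∂μ with hz
  have hzL : MemLp z 2 P := memLp_average hfL
  have hzm : StronglyMeasurable[MeasurableSpace.comap W inferInstance] z := by
    have h1 : Measurable[(MeasurableSpace.comap W inferInstance).prod inferInstance]
        (fun p : Ω × Set.Icc a 1 => C.X p.2 p.1 - m p.2) :=
      C.measurable_X.sub (hmm.comp
        (@measurable_snd _ _ (MeasurableSpace.comap W inferInstance) _))
    exact @StronglyMeasurable.integral_prod_right' Ω (Set.Icc a 1) ℝ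
      (MeasurableSpace.comap W inferInstance) _ _ _ _ _ _
      h1.stronglyMeasurable
  have hz0 : ∫ ω, z ω ∂P = 0 := by
    rw [hz, integral_integral_swap (f := fun ω θ => C.X θ ω - m θ)
      (hfL.integrable (by norm_num))]
    refine (integral_congr_ae (ae_of_all _ fun θ => ?_)).trans (integral_zero _ _)
    rw [integral_sub ((C.memLp_claim θ).integrable (by norm_num)) (integrable_const _)]
    simp [hm]
  have hθq : Integrable (fun θ : Set.Icc a 1 => (θ : ℝ) * q θ) μ := by
    refine (integrable_of_antitone hqa hqb).bdd_mul (c := 1)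
      measurable_subtype_coe.aestronglyMeasurable (ae_of_all _ fun θ => ?_)
    rw [Real.norm_of_nonneg (ha.trans θ.2.1)]
    exact θ.2.2
  have hvi : Integrable v μ := (hmi.sub hθq).sub C.integrable_π
  set r := ∫ θ : Set.Icc a 1, ((θ : ℝ) * q θ + v θ) ∂μ with hr
  have hZ : ((hzL.toLp z : Lp ℝ 2 P) : Ω → ℝ) =ᵐ[P] z := hzL.coeFn_toLp
  -- Minkowski bounds the norm by `∫ √q dμ`, the least-energy property is applied to the profile
  -- `√q`, and the rent bounds `v` from below.
  have hnorm : κ * ‖hzL.toLp z‖ ^ 2 ≤ r := by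
    have h1 : ‖hzL.toLp z‖ ^ 2 ≤ (∫ θ, √(q θ) ∂μ) ^ 2 := by
      rw [sq_norm_eq_integral_of_ae_eq hZ]
      refine integral_sq_average_le hfL hft (integrable_of_antitone hda hdb) fun θ => ?_
      refine Real.sqrt_le_sqrt (le_of_eq ?_)
      simp only [hq]
      rw [variance_eq_integral (C.memLp_claim θ).aestronglyMeasurable.aemeasurable]
    calc κ * ‖hzL.toLp z‖ ^ 2 ≤ κ * (∫ θ, √(q θ) ∂μ) ^ 2 := by gcongr
      _ ≤ ∫ θ, √(q θ) ^ 2 ∂(costMeasure ha1 μ) := hopt _ _ hda hdb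
      _ = ∫ θ, q θ ∂(costMeasure ha1 μ) := by simp only [Real.sq_sqrt (hqb _).1]
      _ ≤ r := by
        rw [hcost, hr]
        refine integral_mono (hθq.add hrent) (hθq.add hvi) fun θ => ?_
        exact add_le_add le_rfl (rent_le_of_subgradient ha1 hqa hsub hir θ)
  have hpos : C.position =ᵐ[P] fun ω => W ω - (hzL.toLp z) ω - r := by
    filter_upwards [hZ, (C.memLp_X.integrable (by norm_num)).prod_right_ae] with ω h1 h2
    have h3 : r = ∫ θ, m θ ∂μ - ∫ θ, C.π θ ∂μ := by
      rw [hr, ← integral_sub hmi C.integrable_π]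
      refine integral_congr_ae (ae_of_all _ fun θ => ?_)
      simp only [hv, hq, hm, utility]
      ring
    rw [h1, h3, Catalogue.position, integral_sub C.integrable_π h2, hz]
    simp only
    rw [integral_sub h2 hmi]
    ring
  refine ⟨hzL.toLp z, ⟨hzm.aestronglyMeasurable.congr hZ.symm, ?_⟩, ?_⟩
  · rw [integral_congr_ae hZ, hz0]
  · rw [C.risk_eq_add hcoh hW _ r hpos]
    gcongr

/-- No profile has unit mass when `μ = 0`. Every position is then `W` alone, so any feasible
catalogue is optimal. -/
theorem exists_isSolution_of_measure_zero (hcoh : IsCoherent ρ) (hW : MemLp W 2 P)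
    (hμ : μ = 0) : ∃ C : Catalogue P W a μ, IsSolution ρ hW C := by
  let C₀ : Catalogue P W a μ :=
    { X := fun _ _ => 0
      π := fun _ => 0
      measurable_X := measurable_const
      memLp_X := MemLp.zero
      memLp_claim := fun _ => MemLp.zero
      integrable_π := integrable_zero _ _ _ }
  have h0 : ∀ g : Set.Icc a 1 → ℝ, ∫ θ, g θ ∂μ = 0 := fun g => by
    rw [hμ, integral_zero_measure]
  have hrisk : ∀ C : Catalogue P W a μ, C.risk ρ hW = ρ (hW.toLp W - 0) + ((0 : ℝ) : EReal) := by
    intro C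
    refine C.risk_eq_add hcoh hW 0 0 ?_
    filter_upwards [Lp.coeFn_zero ℝ 2 P] with ω hω
    rw [hω, Catalogue.position, h0]
    simp
  have hU : ∀ θ θ' : Set.Icc a 1, utility P θ (C₀.X θ') - C₀.π θ' = 0 := by
    intro θ θ'
    have : variance (C₀.X θ') P = 0 := variance_zero P
    rw [utility, this]
    simp [C₀]
  exact ⟨C₀, isSolution_of_forall_le ⟨fun θ θ' => (hU θ θ').trans_le (hU θ θ).ge,
    fun θ => (hU θ θ).ge⟩
    fun C' _ => by rw [hrisk, hrisk]⟩

end Catalogues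

end PrincipalAgent

end

theorem theorem2p1 {Ω : Type*} [MeasurableSpace Ω] (P : Measure Ω) [IsProbabilityMeasure P]
    (W : Ω → ℝ) (hWm : Measurable W) (hW : MemLp W 2 P)
    (a : ℝ) (ha : 0 < a) (ha1 : a ≤ 1)
    (μ : Measure (Set.Icc a 1)) [IsFiniteMeasure μ]
    (ρ : Lp ℝ 2 P → EReal)
    (hcoh : PrincipalAgent.IsCoherent ρ)
    (hlaw : PrincipalAgent.IsLawInvariant ρ)
    (hfatou : PrincipalAgent.HasFatouProperty ρ) :
    ∃ C : PrincipalAgent.Catalogue P W a μ, PrincipalAgent.IsSolution ρ hW C := by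
  by_cases hμ : μ = 0
  · exact PrincipalAgent.exists_isSolution_of_measure_zero hcoh hW hμ
  obtain ⟨c, M, hc, hcb, hc1, hκ, hopt⟩ := PrincipalAgent.exists_optimal_profile μ
    (PrincipalAgent.costMeasure ha1 μ) ha (PrincipalAgent.smul_le_costMeasure ha1 μ) hμ
  obtain ⟨Z, hZ, hmin⟩ := PrincipalAgent.exists_min_risk_add_sq_norm hcoh hfatou
    (PrincipalAgent.isClosed_centredClaims hWm) (PrincipalAgent.convex_centredClaims P W)
    ⟨0, PrincipalAgent.zero_mem_centredClaims P W⟩ (hW.toLp W) hκ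
  obtain ⟨C, hC, hrisk⟩ := PrincipalAgent.exists_catalogue_of_profile (ρ := ρ) hcoh hW ha.le
    ha1 hZ hc hcb hc1
  refine ⟨C, PrincipalAgent.isSolution_of_forall_le hC fun C' hC' => ?_⟩
  obtain ⟨Z', hZ', hle⟩ := PrincipalAgent.exists_centredClaim_le_risk (ρ := ρ) hcoh hWm hW ha.le
    ha1 hκ.le hopt hC'
  rw [hrisk]
  exact (hmin Z' hZ').trans hle
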